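/- Let $\mathcal G$ be a countable directed graph with vertex set $\mathcal G_V$, arrow set $\mathcal G_{Ar}$ (multiple arrows and loops are allowed), and source and range maps $s,r:\mathcal G_{Ar}\to\mathcal G_V$. A set $H\subseteq\mathcal G_V$ is hereditary if $s(a)\in H$ implies $r(a)\in H$ for all arrows $a$, and saturated if $v\in H$ whenever $v$ emits at least one and only finitely many arrows and all of them have range in $H$. Assume that $\mathcal G$ is cofinal, i.e. that the only non-empty subset of $\mathcal G_V$ that is both hereditary and saturated is $\mathcal G_V$ itself, and that the set $NW_{\mathcal G}$ of non-wandering vertices, i.e. of vertices $v$ for which there is a finite path of positive length from $v$ to $v$, is non-empty. Let $P(\mathcal G)=\{p\in(\mathcal G_{Ar})^{\mathbb N}: r(p_i)=s(p_{i+1}) \text{ for all } i\}$ be the space of infinite paths, with the topology inherited from the product of the discrete spaces $\mathcal G_{Ar}$, and let $\sigma(p)_i=p_{i+1}$ be the shift. Put $Z(v)=\{p\in P(\mathcal G): s(p_1)=v\}$ for a vertex $v$ and $Z(a)=\{p\in P(\mathcal G): p_1=a\}$ for an arrow $a$. Let $F:\mathcal G_{Ar}\to\mathbb R$ and $\beta\in\mathbb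 R$. A non-zero Borel measure $m$ on $P(\mathcal G)$ is called $e^{\beta F}$-conformal if $m(Z(v))<\infty$ for every vertex $v$ and $m(\sigma(B\cap Z(a)))=e^{\beta F(a)}m(B\cap Z(a))$ for every arrow $a$ and every Borel set $B\subseteq P(\mathcal G)$. Let $A(\beta)$ be the matrix over $\mathcal G_V$ with entries $A(\beta)_{v,w}=\sum_{a:\,s(a)=v,\,r(a)=w}e^{-\beta F(a)}\in[0,\infty]$. Set $$P(\mathcal G)_{rec}=\{p: \text{every arrow } a \text{ with } s(a)\in NW_{\mathcal G} \text{ equals } p_i \text{ for infinitely many } i\},$$ $$P(\mathcal G)_{wan}=\{p: \text{for every vertex } v,\ s(p_i)=v \text{ for only finitely many } i\}.$$ Then every $e^{\beta F}$-conformal measure $m$ on $P(\mathcal G)$ is concentrated on exactly one of $P(\mathcal G)_{rec}$ and $P(\mathcal G)_{wan}$ (a measure is concentrated on a set if the complement of the set is a null set). Moreover, - $m$ is concentrated on $P(\mathcal G)_{rec}$ if and only if $\sum_{n=0}^\infty A(\beta)^n_{v,v}=\infty$ for one, and hence for all, $v\in NW_{\mathcal G}$; - $m$ is concentrated on $P(\mathcal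 G)_{wan}$ if and only if $\sum_{n=0}^\infty A(\beta)^n_{v,v}<\infty$ for one, and hence for all, $v\in NW_{\mathcal G}$. -/

import Mathlib

open MeasureTheory

/-- A directed graph with vertex set `V` and arrow set `E`; multiple arrows between the same
vertices and loops are allowed. -/
structure DirGraph (V E : Type*) where
  /-- The source of an arrow. -/
  s : E → V
  /-- The range of an arrow. -/
  r : E → V

namespace DirGraph

variable {V E : Type*} (G : DirGraph V E)

/-- The set of sinks and infinite emitters. -/
def Vinf : Set V := {v | {a | G.s a = v} = ∅ ∨ {a | G.s a = v}.Infinite}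

/-- Hereditary sets of vertices. -/
def Hereditary (H : Set V) : Prop := ∀ a, G.s a ∈ H → G.r a ∈ H

/-- Saturated sets of vertices. -/
def Saturated (H : Set V) : Prop :=
  ∀ v, v ∉ G.Vinf → (∀ a, G.s a = v → G.r a ∈ H) → v ∈ H

/-- `G` is cofinal when the only non-empty hereditary and saturated set of vertices is the set of
all vertices. -/
def Cofinal : Prop :=
  ∀ H : Set V, H.Nonempty → G.Hereditary H → G.Saturated H → H = Set.univ

/-- The non-wandering vertices: those `v` for which there is a finite path of positive length
from `v` to `v`. -/
def NW : Set V :=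
  {v | ∃ (μ : List E) (h : μ ≠ []), μ.IsChain (fun a b => G.r a = G.s b) ∧
    G.s (μ.head h) = v ∧ G.r (μ.getLast h) = v}

/-- The space of infinite paths; the first arrow of a path has index `0`. -/
def InfPath : Type _ := {p : ℕ → E // ∀ i, G.r (p i) = G.s (p (i + 1))}

/-- The topology of the path space: the subspace topology from the product of countably many
copies of the discrete space of arrows. -/
instance : TopologicalSpace G.InfPath :=
  TopologicalSpace.induced Subtype.val (@Pi.topologicalSpace ℕ (fun _ => E) (fun _ => ⊥))

/-- The Borel σ-algebra of the path space. -/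
instance : MeasurableSpace G.InfPath := borel G.InfPath

instance : BorelSpace G.InfPath := ⟨rfl⟩

/-- The shift `σ(p)_i = p_{i+1}`. -/
def shift (p : G.InfPath) : G.InfPath := ⟨fun i => p.1 (i + 1), fun i => p.2 (i + 1)⟩

/-- The cylinder of a vertex: the infinite paths that start at `v`. -/
def cylV (v : V) : Set G.InfPath := {p | G.s (p.1 0) = v}

/-- The cylinder of an arrow: the infinite paths whose first arrow is `a`. -/
def cylE (a : E) : Set G.InfPath := {p | p.1 0 = a}

/-- The non-zero Borel measures `m` on the path space that are `e^{βF}`-conformal. -/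
structure IsConformal (F : E → ℝ) (β : ℝ) (m : Measure G.InfPath) : Prop where
  ne_zero : m ≠ 0
  finite_cylV : ∀ v, m (G.cylV v) < ⊤
  conformal : ∀ (a : E) (B : Set G.InfPath), MeasurableSet B →
    m (G.shift '' (B ∩ G.cylE a)) = ENNReal.ofReal (Real.exp (β * F a)) * m (B ∩ G.cylE a)

/-- The recurrent paths: every arrow that starts in a non-wandering vertex occurs infinitely
often. -/
def recPaths : Set G.InfPath := {p | ∀ a, G.s a ∈ G.NW → {i | p.1 i = a}.Infinite}

/-- The wandering paths: every vertex is visited only finitely often. -/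
def wanPaths : Set G.InfPath := {p | ∀ v, {i | G.s (p.1 i) = v}.Finite}

/-- The measure `m` is concentrated on the set `S`. -/
def ConcentratedOn (m : Measure G.InfPath) (S : Set G.InfPath) : Prop := m Sᶜ = 0

/-- The matrix `A(β)`, with entries in `[0, ∞]`: `A(β)_{v,w}` is the sum of `e^{-βF(a)}` over all
arrows `a` from `v` to `w`. -/
noncomputable def A (F : E → ℝ) (β : ℝ) (v w : V) : ENNReal :=
  ∑' a : {a : E // G.s a = v ∧ G.r a = w}, ENNReal.ofReal (Real.exp (-β * F a))

open Classical in
/-- The powers `A(β)^n` of the matrix `A(β)`, with entries in `[0, ∞]`. -/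
noncomputable def Apow (F : E → ℝ) (β : ℝ) : ℕ → V → V → ENNReal
  | 0, v, w => if v = w then 1 else 0
  | n + 1, v, w => ∑' u, G.A F β v u * Apow F β n u w

end DirGraph

/-! Conformality makes the measure propagate by the matrix: for B inside Z(v), the set of paths from
w whose n-th shift lies in B has measure `A(β)^n_{w,v} m(B)`
(`measure_preimage_iterate_inter_cylV`). If the diagonal sum at v converges, take B = Z(v):
Borel–Cantelli shows that almost no path from v returns to v infinitely often. If it diverges at
s(e), let B be the paths that start with e and never repeat it. The sets where e occurs last at time
n are disjoint in Z(s(e)), of finite measure, so m(B) = 0. Both conclusions are local; cofinality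
spreads them to all paths through `measure_eq_zero_of_invariant`, and makes convergence independent
of the non-wandering vertex. -/

namespace DirGraph

variable {V E : Type*} (G : DirGraph V E)

/-! ### Powers of the matrix and connectivity. -/

section Matrix

variable (F : E → ℝ) (β : ℝ)

lemma A_ne_zero_of_arrow (a : E) : G.A F β (G.s a) (G.r a) ≠ 0 := by
  intro h
  have h' := ENNReal.tsum_eq_zero.1 h ⟨a, rfl, rfl⟩
  rw [ENNReal.ofReal_eq_zero] at h'
  exact absurd h' (not_le.2 (Real.exp_pos _))

lemma exists_arrow_of_A_ne_zero {v w : V} (h : G.A F β v w ≠ 0) :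
    ∃ a, G.s a = v ∧ G.r a = w := by
  by_contra hne
  push Not at hne
  exact h (ENNReal.tsum_eq_zero.2 fun a => absurd a.2.2 (hne a a.2.1))

lemma Apow_zero_self (v : V) : G.Apow F β 0 v v = 1 := by
  simp [Apow]

lemma A_mul_Apow_le (n : ℕ) (v u w : V) :
    G.A F β v u * G.Apow F β n u w ≤ G.Apow F β (n + 1) v w :=
  ENNReal.le_tsum (f := fun u => G.A F β v u * G.Apow F β n u w) u

lemma Apow_mul_Apow_le (k n : ℕ) (u v w : V) :
    G.Apow F β k u v * G.Apow F β n v w ≤ G.Apow F β (k + n) u w := by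
  induction k generalizing u with
  | zero =>
    by_cases h : u = v
    · subst h
      simp [Apow_zero_self]
    · simp [Apow, h]
  | succ k ih =>
    rw [Nat.add_right_comm]
    simp only [Apow]
    rw [← ENNReal.tsum_mul_right]
    refine ENNReal.tsum_le_tsum fun x => ?_
    rw [mul_assoc]
    gcongr
    exact ih x

lemma Apow_length_ne_zero (μ : List E) (h : μ ≠ [])
    (hc : μ.IsChain (fun a b => G.r a = G.s b)) :
    G.Apow F β μ.length (G.s (μ.head h)) (G.r (μ.getLast h)) ≠ 0 := by
  induction μ with
  | nil => exact absurd rfl h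
  | cons a μ ih =>
    have hA := G.A_ne_zero_of_arrow F β a
    refine fun h0 => ?_
    have hle := G.A_mul_Apow_le F β μ.length (G.s a) (G.r a) (G.r ((a :: μ).getLast h))
    rw [List.head_cons, List.length_cons] at h0
    rw [h0, nonpos_iff_eq_zero, mul_eq_zero] at hle
    rcases hle with hle | hle
    · exact hA hle
    · cases μ with
      | nil => simp [Apow] at hle
      | cons b μ =>
        rw [List.isChain_cons_cons] at hc
        rw [List.getLast_cons (List.cons_ne_nil b μ), hc.1] at hle
        exact ih (List.cons_ne_nil b μ) hc.2 hle

lemma exists_Apow_succ_ne_zero_of_mem_NW {v : V} (hv : v ∈ G.NW) :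
    ∃ n, G.Apow F β (n + 1) v v ≠ 0 := by
  obtain ⟨μ, h, hc, hs, hr⟩ := hv
  have h0 := G.Apow_length_ne_zero F β μ h hc
  rw [hs, hr] at h0
  refine ⟨μ.length - 1, ?_⟩
  rwa [Nat.sub_add_cancel (List.length_pos_iff.2 h)]

/-- In a cofinal graph every vertex is connected to every non-wandering vertex. -/
lemma Cofinal.exists_Apow_succ_ne_zero {G : DirGraph V E} (hcof : G.Cofinal) (u : V) {w : V}
    (hw : w ∈ G.NW) : ∃ n, G.Apow F β (n + 1) u w ≠ 0 := by
  by_contra hu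
  push Not at hu
  obtain ⟨k, hk⟩ := G.exists_Apow_succ_ne_zero_of_mem_NW F β hw
  -- The vertices with no path of positive length to `w` form a hereditary and saturated set, which
  -- misses `w`.
  have huniv := hcof {x | ∀ n, G.Apow F β (n + 1) x w = 0} ⟨u, hu⟩ ?_ ?_
  · exact hk ((huniv ▸ Set.mem_univ w : w ∈ {x | ∀ n, G.Apow F β (n + 1) x w = 0}) k)
  · intro a ha n
    have hle := G.A_mul_Apow_le F β (n + 1) (G.s a) (G.r a) w
    rw [ha (n + 1), nonpos_iff_eq_zero, mul_eq_zero] at hle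
    exact hle.resolve_left (G.A_ne_zero_of_arrow F β a)
  · intro v _ hv n
    refine ENNReal.tsum_eq_zero.2 fun x => ?_
    by_cases hx : G.A F β v x = 0
    · simp [hx]
    obtain ⟨a, has, har⟩ := G.exists_arrow_of_A_ne_zero F β hx
    have hxH := hv a has
    rw [har] at hxH
    cases n with
    | zero =>
      have hne : x ≠ w := fun h => hk (h ▸ hxH k)
      simp [Apow, hne]
    | succ n => rw [hxH n, mul_zero]

/-- The finiteness of `∑ A(β)^n_{v,v}` does not depend on the non-wandering vertex `v`. -/
lemma Cofinal.tsum_Apow_lt_top {G : DirGraph V E} (hcof : G.Cofinal) {u v : V}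
    (hu : u ∈ G.NW) (hv : v ∈ G.NW) (h : ∑' n, G.Apow F β n u u < ⊤) :
    ∑' n, G.Apow F β n v v < ⊤ := by
  obtain ⟨k, hk⟩ := hcof.exists_Apow_succ_ne_zero F β u hv
  obtain ⟨l, hl⟩ := hcof.exists_Apow_succ_ne_zero F β v hu
  -- Loops at `v`, preceded by a path from `u` and followed by one back to `u`, are loops at `u`.
  have hle : G.Apow F β (k + 1) u v * (∑' n, G.Apow F β n v v) * G.Apow F β (l + 1) v u ≤
      ∑' n, G.Apow F β n u u := by
    rw [← ENNReal.tsum_mul_left, ← ENNReal.tsum_mul_right]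
    calc _ ≤ ∑' n, G.Apow F β (k + 1 + n + (l + 1)) u u := by
          refine ENNReal.tsum_le_tsum fun n => ?_
          refine le_trans ?_ (G.Apow_mul_Apow_le F β (k + 1 + n) (l + 1) u v u)
          gcongr
          exact G.Apow_mul_Apow_le F β (k + 1) n u v v
      _ ≤ _ := ENNReal.tsum_comp_le_tsum_of_injective (f := fun n => k + 1 + n + (l + 1))
          (fun a b hab => by simpa using hab) _
  by_contra htop
  rw [not_lt, top_le_iff] at htop
  rw [htop, ENNReal.mul_top hk, ENNReal.top_mul hl, top_le_iff] at hle
  exact h.ne hle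

end Matrix

/-! ### Paths, the shift and measurability. -/

section PathSpace

lemma shift_iterate_apply (n : ℕ) (p : G.InfPath) (i : ℕ) :
    (G.shift^[n] p).1 i = p.1 (i + n) := by
  induction n generalizing p with
  | zero => rfl
  | succ n ih =>
    rw [Function.iterate_succ_apply, ih]
    rfl

/-- The arrows with indices from `i` to `j - 1` form a closed path. -/
lemma mem_NW_of_source_eq (p : G.InfPath) {i j : ℕ} (hij : i < j)
    (h : G.s (p.1 i) = G.s (p.1 j)) : G.s (p.1 i) ∈ G.NW := by
  obtain ⟨k, rfl⟩ : ∃ k, j = i + k + 1 := ⟨j - i - 1, by omega⟩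
  have hne : (List.ofFn fun x : Fin (k + 1) => p.1 (i + x)) ≠ [] := by simp
  refine ⟨List.ofFn fun x : Fin (k + 1) => p.1 (i + x), hne, ?_, ?_, ?_⟩
  · rw [List.isChain_iff_getElem]
    intro x hx
    rw [List.getElem_ofFn, List.getElem_ofFn]
    exact p.2 (i + x)
  · simp
  · rw [List.getLast_ofFn]
    simpa [h] using p.2 (i + k)

lemma measurableSet_coord_eq (i : ℕ) (a : E) : MeasurableSet {p : G.InfPath | p.1 i = a} := by
  let _ : TopologicalSpace E := ⊥
  have : DiscreteTopology E := ⟨rfl⟩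
  have hc : Continuous fun p : G.InfPath => p.1 i :=
    (continuous_apply i).comp continuous_induced_dom
  exact ((isOpen_discrete {a}).preimage hc).measurableSet

lemma measurable_shift : Measurable G.shift := by
  let _ : TopologicalSpace E := ⊥
  have hc : Continuous G.shift := by
    refine continuous_induced_rng.2 (continuous_pi fun i => ?_)
    exact (continuous_apply (i + 1)).comp continuous_induced_dom
  exact hc.measurable

lemma measurableSet_cylE (a : E) : MeasurableSet (G.cylE a) := G.measurableSet_coord_eq 0 a

lemma cylV_eq_iUnion (v : V) : G.cylV v = ⋃ a : {a // G.s a = v}, G.cylE a := by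
  ext p
  simp [cylV, cylE]

lemma measurableSet_cylV [Countable E] (v : V) : MeasurableSet (G.cylV v) := by
  rw [cylV_eq_iUnion]
  exact MeasurableSet.iUnion fun a => G.measurableSet_cylE a

lemma measurableSet_coord_infinite (a : E) :
    MeasurableSet {p : G.InfPath | {i | p.1 i = a}.Infinite} := by
  have : {p : G.InfPath | {i | p.1 i = a}.Infinite} =
      ⋂ n : ℕ, ⋃ i : ℕ, ⋃ _ : n < i, {p | p.1 i = a} := by
    ext p
    simp only [Set.mem_ofPred_eq, Set.mem_iInter, Set.mem_iUnion, Set.infinite_iff_exists_gt,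
      exists_prop, and_comm]
  rw [this]
  exact .iInter fun n => .iUnion fun i => .iUnion fun _ => G.measurableSet_coord_eq i a

lemma measurableSet_visit_infinite [Countable E] (v : V) :
    MeasurableSet {p : G.InfPath | {i | G.s (p.1 i) = v}.Infinite} := by
  have : {p : G.InfPath | {i | G.s (p.1 i) = v}.Infinite} =
      ⋂ n : ℕ, ⋃ i : ℕ, ⋃ _ : n < i, ⋃ a : {a // G.s a = v}, {p | p.1 i = a.1} := by
    ext p
    simp [Set.infinite_iff_exists_gt, and_comm]
  rw [this]
  exact .iInter fun n => .iUnion fun i => .iUnion fun _ => .iUnion fun a =>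
    G.measurableSet_coord_eq i a

/-- The paths that start with the arrow `e` and never use it again. -/
def arrowOnlyFirst (e : E) : Set G.InfPath := {p | p.1 0 = e ∧ ∀ i, p.1 (i + 1) ≠ e}

lemma measurableSet_arrowOnlyFirst (e : E) : MeasurableSet (G.arrowOnlyFirst e) := by
  have : G.arrowOnlyFirst e = {p | p.1 0 = e} ∩ ⋂ i, {p | p.1 (i + 1) = e}ᶜ := by
    ext p
    simp [arrowOnlyFirst]
  rw [this]
  exact (G.measurableSet_coord_eq 0 e).inter
    (.iInter fun i => (G.measurableSet_coord_eq (i + 1) e).compl)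

lemma arrowOnlyFirst_subset_cylV (e : E) : G.arrowOnlyFirst e ⊆ G.cylV (G.s e) :=
  fun _ hp => congrArg G.s hp.1

lemma mem_preimage_iterate_arrowOnlyFirst_iff {e : E} {n : ℕ} {p : G.InfPath} :
    p ∈ G.shift^[n] ⁻¹' G.arrowOnlyFirst e ↔ p.1 n = e ∧ ∀ j, n < j → p.1 j ≠ e := by
  simp only [arrowOnlyFirst, Set.mem_preimage, Set.mem_ofPred_eq, shift_iterate_apply, zero_add]
  refine and_congr_right fun _ => ⟨fun h j hj => ?_, fun h i => h _ (by omega)⟩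
  have := h (j - n - 1)
  rwa [show j - n - 1 + 1 + n = j by omega] at this

lemma shift_image_preimage_inter_cylE (C : Set G.InfPath) (a : E) :
    G.shift '' (G.shift ⁻¹' C ∩ G.cylE a) = C ∩ G.cylV (G.r a) := by
  ext q
  constructor
  · rintro ⟨p, ⟨hpC, hpa⟩, rfl⟩
    refine ⟨hpC, ?_⟩
    have := p.2 0
    rw [show p.1 0 = a from hpa] at this
    exact this.symm
  · rintro ⟨hqC, hqa⟩
    let f : ℕ → E := fun i => Nat.casesOn i a q.1
    have hf : ∀ i, G.r (f i) = G.s (f (i + 1)) := fun i => by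
      cases i with
      | zero => exact Eq.symm hqa
      | succ i => exact q.2 i
    exact ⟨⟨f, hf⟩, ⟨hqC, rfl⟩, rfl⟩

lemma infinite_setOf_succ_iff {P : ℕ → Prop} :
    {i | P (i + 1)}.Infinite ↔ {i | P i}.Infinite := by
  simp only [← Nat.frequently_atTop_iff_infinite]
  exact Filter.frequently_map.symm.trans (by rw [Filter.map_add_atTop_eq_nat 1])

end PathSpace

/-! ### Consequences of conformality. -/

namespace IsConformal

variable {G} {F : E → ℝ} {β : ℝ} {m : Measure G.InfPath} (hm : G.IsConformal F β m)
include hm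

lemma measure_preimage_shift_inter_cylE {C : Set G.InfPath} (hC : MeasurableSet C) (a : E) :
    m (G.shift ⁻¹' C ∩ G.cylE a) =
      ENNReal.ofReal (Real.exp (-β * F a)) * m (C ∩ G.cylV (G.r a)) := by
  have h := hm.conformal a _ (G.measurable_shift hC)
  rw [G.shift_image_preimage_inter_cylE] at h
  rw [h, ← mul_assoc, ← ENNReal.ofReal_mul (Real.exp_pos _).le, ← Real.exp_add]
  simp

variable [Countable E]

/-- Split by the first arrow and group the arrows by their range. -/
lemma measure_preimage_shift_inter_cylV {C : Set G.InfPath} (hC : MeasurableSet C) (v : V) :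
    m (G.shift ⁻¹' C ∩ G.cylV v) = ∑' u, G.A F β v u * m (C ∩ G.cylV u) := by
  rw [cylV_eq_iUnion, Set.inter_iUnion, measure_iUnion]
  · simp only [A, ← ENNReal.tsum_mul_right]
    rw [← ENNReal.tsum_sigma' (β := fun u => {a : E // G.s a = v ∧ G.r a = u})
      (fun x => ENNReal.ofReal (Real.exp (-β * F x.2)) * m (C ∩ G.cylV x.1))]
    let e : {a // G.s a = v} ≃ Σ u, {a : E // G.s a = v ∧ G.r a = u} :=
      { toFun := fun a => ⟨G.r a, a, a.2, rfl⟩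
        invFun := fun x => ⟨x.2, x.2.2.1⟩
        left_inv := fun a => rfl
        right_inv := by
          rintro ⟨u, a, rfl, rfl⟩
          rfl }
    rw [← e.tsum_eq]
    exact tsum_congr fun a => hm.measure_preimage_shift_inter_cylE hC a
  · intro a b hab
    refine Set.disjoint_left.2 fun p hp hq => hab (Subtype.ext ?_)
    exact hp.2.symm.trans hq.2
  · exact fun a => (G.measurable_shift hC).inter (G.measurableSet_cylE a)

lemma measure_preimage_iterate_inter_cylV {B : Set G.InfPath} (hB : MeasurableSet B) {v : V}
    (hBv : B ⊆ G.cylV v) (n : ℕ) (w : V) :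
    m (G.shift^[n] ⁻¹' B ∩ G.cylV w) = G.Apow F β n w v * m B := by
  induction n generalizing w with
  | zero =>
    by_cases h : w = v
    · subst h
      simp [Apow, Set.inter_eq_left.2 hBv]
    · have : B ∩ G.cylV w = ∅ := by
        refine Set.eq_empty_of_forall_notMem fun p hp => h ?_
        exact hp.2.symm.trans (hBv hp.1)
      simp [Apow, h, this]
  | succ n ih =>
    rw [Function.iterate_succ, Set.preimage_comp,
      hm.measure_preimage_shift_inter_cylV (G.measurable_shift.iterate n hB)]
    simp only [ih, Apow, ← ENNReal.tsum_mul_right, mul_assoc]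

/-- A shift-invariant set whose intersection with one vertex cylinder is null is null. -/
lemma measure_eq_zero_of_invariant [Countable V] (hcof : G.Cofinal) {M : Set G.InfPath}
    (hM : MeasurableSet M) (hinv : G.shift ⁻¹' M = M) {v : V} (hv : m (M ∩ G.cylV v) = 0) :
    m M = 0 := by
  -- By invariance, `w ↦ m (M ∩ G.cylV w)` is a non-negative harmonic vector for the matrix, so its
  -- zero set is hereditary and saturated.
  have harm : ∀ w, m (M ∩ G.cylV w) = ∑' u, G.A F β w u * m (M ∩ G.cylV u) := fun w => by
    rw [← hm.measure_preimage_shift_inter_cylV hM, hinv]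
  have huniv := hcof {w | m (M ∩ G.cylV w) = 0} ⟨v, hv⟩ ?_ ?_
  · have hcover : M = ⋃ w, M ∩ G.cylV w := by
      ext p
      simp [cylV]
    rw [hcover, measure_iUnion_null_iff]
    exact fun w => (huniv ▸ Set.mem_univ w : w ∈ {w | m (M ∩ G.cylV w) = 0})
  · intro a ha
    rw [Set.mem_ofPred_eq, harm, ENNReal.tsum_eq_zero] at ha
    exact (mul_eq_zero.1 (ha (G.r a))).resolve_left (G.A_ne_zero_of_arrow F β a)
  · intro w _ hw
    rw [Set.mem_ofPred_eq, harm, ENNReal.tsum_eq_zero]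
    intro u
    by_cases hu : G.A F β w u = 0
    · simp [hu]
    obtain ⟨a, has, har⟩ := G.exists_arrow_of_A_ne_zero F β hu
    have := hw a has
    rw [har] at this
    rw [show m (M ∩ G.cylV u) = 0 from this, mul_zero]

lemma measure_visit_infinite_eq_zero [Countable V] (hcof : G.Cofinal) {v : V}
    (h : ∑' n, G.Apow F β n v v < ⊤) : m {p | {i | G.s (p.1 i) = v}.Infinite} = 0 := by
  refine hm.measure_eq_zero_of_invariant hcof (G.measurableSet_visit_infinite v) ?_ (v := v) ?_
  · ext p
    exact infinite_setOf_succ_iff (P := fun i => G.s (p.1 i) = v)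
  · have hsum : ∑' n, m {p | p ∈ G.shift^[n] ⁻¹' G.cylV v ∩ G.cylV v} ≠ ⊤ := by
      simp only [Set.ofPred_mem_eq,
        hm.measure_preimage_iterate_inter_cylV (G.measurableSet_cylV v) subset_rfl]
      rw [ENNReal.tsum_mul_right]
      exact ENNReal.mul_ne_top h.ne (hm.finite_cylV v).ne
    refine measure_mono_null ?_ (measure_setOfPred_frequently_eq_zero hsum)
    rintro p ⟨hp, hpv⟩
    refine (Nat.frequently_atTop_iff_infinite.2 hp).mono fun n hn => ⟨?_, hpv⟩
    simpa [cylV, shift_iterate_apply] using hn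

lemma measure_arrowOnlyFirst_eq_zero {e : E}
    (h : ∑' n, G.Apow F β n (G.s e) (G.s e) = ⊤) : m (G.arrowOnlyFirst e) = 0 := by
  have hLm := G.measurableSet_arrowOnlyFirst e
  have hdisj : Pairwise (Function.onFun Disjoint
      fun n => G.shift^[n] ⁻¹' G.arrowOnlyFirst e ∩ G.cylV (G.s e)) := by
    intro i j hij
    refine Set.disjoint_left.2 fun p hp hq => ?_
    have hi := G.mem_preimage_iterate_arrowOnlyFirst_iff.1 hp.1
    have hj := G.mem_preimage_iterate_arrowOnlyFirst_iff.1 hq.1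
    rcases lt_or_gt_of_ne hij with hlt | hlt
    · exact hi.2 j hlt hj.1
    · exact hj.2 i hlt hi.1
  have hsum : (∑' n, G.Apow F β n (G.s e) (G.s e)) * m (G.arrowOnlyFirst e) ≤
      m (G.cylV (G.s e)) := by
    rw [← ENNReal.tsum_mul_right]
    simp only [← hm.measure_preimage_iterate_inter_cylV hLm
      (G.arrowOnlyFirst_subset_cylV e)]
    rw [← measure_iUnion hdisj fun n =>
      (G.measurable_shift.iterate n hLm).inter (G.measurableSet_cylV _)]
    exact measure_mono (Set.iUnion_subset fun n => Set.inter_subset_right)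
  by_contra h0
  rw [h, ENNReal.top_mul h0, top_le_iff] at hsum
  exact (hm.finite_cylV _).ne hsum

lemma measure_arrow_finite_eq_zero [Countable V] (hcof : G.Cofinal) {e : E}
    (h : ∑' n, G.Apow F β n (G.s e) (G.s e) = ⊤) :
    m {p | {i | p.1 i = e}.Infinite}ᶜ = 0 := by
  set M : Set G.InfPath := {p | {i | p.1 i = e}.Infinite}ᶜ with hMdef
  have hM : MeasurableSet M := (G.measurableSet_coord_infinite e).compl
  have hinv : G.shift ⁻¹' M = M := by
    ext p
    exact not_congr (infinite_setOf_succ_iff (P := fun i => p.1 i = e))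
  -- A path in `M` that starts with `e` has a last occurrence of `e`, so `M ∩ G.cylE e` is null;
  -- shifting past `e` carries this to the cylinder of `G.r e`.
  refine hm.measure_eq_zero_of_invariant hcof hM hinv (v := G.r e) ?_
  have hME : m (M ∩ G.cylE e) = 0 := by
    have hnull : m (⋃ n, G.shift^[n] ⁻¹' G.arrowOnlyFirst e ∩ G.cylV (G.s e)) = 0 := by
      refine measure_iUnion_null fun n => ?_
      rw [hm.measure_preimage_iterate_inter_cylV (G.measurableSet_arrowOnlyFirst e)
        (G.arrowOnlyFirst_subset_cylV e), hm.measure_arrowOnlyFirst_eq_zero h, mul_zero]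
    refine measure_mono_null ?_ hnull
    rintro p ⟨hp, hpe⟩
    obtain ⟨n, hn, hmax⟩ := Set.exists_max_image _ id (Set.not_infinite.1 hp) ⟨0, hpe⟩
    refine Set.mem_iUnion.2 ⟨n, G.mem_preimage_iterate_arrowOnlyFirst_iff.2 ⟨hn, ?_⟩,
      congrArg G.s hpe⟩
    exact fun j hj hje => absurd (hmax j hje) (not_le.2 hj)
  rw [← hinv, hm.measure_preimage_shift_inter_cylE hM, mul_eq_zero] at hME
  exact hME.resolve_left (by simp [Real.exp_pos])

/-- A vertex visited twice is non-wandering, so only the countably many vertices of `G.NW` need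
checking. -/
lemma concentratedOn_wanPaths [Countable V] (hcof : G.Cofinal)
    (h : ∀ v ∈ G.NW, ∑' n, G.Apow F β n v v < ⊤) : G.ConcentratedOn m G.wanPaths := by
  have hnull : m (⋃ v : G.NW, {p | {i | G.s (p.1 i) = v}.Infinite}) = 0 :=
    measure_iUnion_null fun v => hm.measure_visit_infinite_eq_zero hcof (h v v.2)
  refine measure_mono_null (fun p hp => ?_) hnull
  simp only [wanPaths, Set.mem_compl_iff, Set.mem_ofPred_eq, not_forall] at hp
  obtain ⟨v, hv⟩ := hp
  have hv : {i | G.s (p.1 i) = v}.Infinite := hv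
  obtain ⟨i, hi⟩ := hv.nonempty
  obtain ⟨j, hj, hij⟩ := hv.exists_gt i
  have hNW := G.mem_NW_of_source_eq p hij (Eq.trans hi (Eq.symm hj))
  rw [show G.s (p.1 i) = v from hi] at hNW
  exact Set.mem_iUnion.2 ⟨⟨v, hNW⟩, hv⟩

lemma concentratedOn_recPaths [Countable V] (hcof : G.Cofinal)
    (h : ∀ v ∈ G.NW, ∑' n, G.Apow F β n v v = ⊤) : G.ConcentratedOn m G.recPaths := by
  have hnull : m (⋃ e : {e // G.s e ∈ G.NW}, {p | {i | p.1 i = e.1}.Infinite}ᶜ) = 0 :=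
    measure_iUnion_null fun e => hm.measure_arrow_finite_eq_zero hcof (h _ e.2)
  refine measure_mono_null (fun p hp => ?_) hnull
  simp only [recPaths, Set.mem_compl_iff, Set.mem_ofPred_eq, not_forall] at hp
  obtain ⟨e, he, hfin⟩ := hp
  exact Set.mem_iUnion.2 ⟨⟨e, he⟩, hfin⟩

-- A non-wandering vertex emits an arrow; a recurrent path uses it, hence visits the vertex,
-- infinitely often, so the two sets of paths are disjoint.
omit [Countable E] in
lemma not_concentratedOn_both (hNW : G.NW.Nonempty) (hrec : G.ConcentratedOn m G.recPaths)
    (hwan : G.ConcentratedOn m G.wanPaths) : False := by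
  refine hm.ne_zero (Measure.measure_univ_eq_zero.1 ?_)
  refine measure_mono_null (fun p _ => ?_) (measure_union_null hrec hwan)
  rw [← Set.compl_inter]
  rintro ⟨hpr, hpw⟩
  obtain ⟨v, μ, hne, hc, hs, hr⟩ := hNW
  have hinf : {i | p.1 i = μ.head hne}.Infinite :=
    hpr _ (by rw [hs]; exact ⟨μ, hne, hc, hs, hr⟩)
  exact hinf ((hpw v).subset fun i (hi : p.1 i = μ.head hne) => (congrArg G.s hi).trans hs)

end IsConformal

end DirGraph

theorem theorem2p6 {V E : Type*} [Countable V] [Countable E] (G : DirGraph V E)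
    (hcof : G.Cofinal) (hNW : G.NW.Nonempty) (F : E → ℝ) (β : ℝ)
    (m : Measure G.InfPath) (hm : G.IsConformal F β m) :
    Xor (G.ConcentratedOn m G.recPaths) (G.ConcentratedOn m G.wanPaths) ∧
    (G.ConcentratedOn m G.recPaths ↔ ∃ v ∈ G.NW, ∑' n, G.Apow F β n v v = ⊤) ∧
    (G.ConcentratedOn m G.recPaths ↔ ∀ v ∈ G.NW, ∑' n, G.Apow F β n v v = ⊤) ∧
    (G.ConcentratedOn m G.wanPaths ↔ ∃ v ∈ G.NW, ∑' n, G.Apow F β n v v < ⊤) ∧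
    (G.ConcentratedOn m G.wanPaths ↔ ∀ v ∈ G.NW, ∑' n, G.Apow F β n v v < ⊤) := by
  have hnot := hm.not_concentratedOn_both hNW
  obtain ⟨v₀, hv₀⟩ := hNW
  by_cases h : ∑' n, G.Apow F β n v₀ v₀ < ⊤
  · have hall : ∀ v ∈ G.NW, ∑' n, G.Apow F β n v v < ⊤ := fun v hv =>
      hcof.tsum_Apow_lt_top F β hv₀ hv h
    have hwan := hm.concentratedOn_wanPaths hcof hall
    have hrec : ¬ G.ConcentratedOn m G.recPaths := fun hrec => hnot hrec hwan
    refine ⟨Or.inr ⟨hwan, hrec⟩, iff_of_false hrec ?_, iff_of_false hrec ?_,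
      iff_of_true hwan ⟨v₀, hv₀, h⟩, iff_of_true hwan hall⟩
    · rintro ⟨v, hv, htop⟩
      exact (hall v hv).ne htop
    · exact fun htop => h.ne (htop v₀ hv₀)
  · have hall : ∀ v ∈ G.NW, ∑' n, G.Apow F β n v v = ⊤ := fun v hv => by
      by_contra hne
      exact h (hcof.tsum_Apow_lt_top F β hv hv₀ (lt_top_iff_ne_top.2 hne))
    have hrec := hm.concentratedOn_recPaths hcof hall
    have hwan : ¬ G.ConcentratedOn m G.wanPaths := hnot hrec
    refine ⟨Or.inl ⟨hrec, hwan⟩, iff_of_true hrec ⟨v₀, hv₀, hall v₀ hv₀⟩, iff_of_true hrec hall,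
      iff_of_false hwan ?_, iff_of_false hwan ?_⟩
    · rintro ⟨v, hv, hlt⟩
      exact hlt.ne (hall v hv)
    · exact fun hlt => h (hlt v₀ hv₀)
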